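/- **Instance.** Let $G=(V,E)$ be a finite directed graph (without parallel edges) with $n=|V|$ nodes and $m=|E|$ edges, $V=\{v_1=s,\dots,v_n=t\}$ with $s\ne t$, such that $s$ has no incoming edges, $t$ has no outgoing edges, and every node other than $t$ has out-degree greater than $1$. Let $\delta(i)$ be the out-degree of $v_i$, fix an arbitrary order of the children of each node, and let $v_{c(i,j)}$ be the $((j \bmod \delta(i))+1)$-th child of $v_i$. Let $\ddagger,\#,\$$ and $W=\{w_1,\dots,w_{n-1}\}$ be additional letters. Put $A_{i,j}=w_i\,v_{c(i,j)}\,w_i$ and $B_{i,j}=v_{c(i,j)}\,w_i\,v_{c(i,j+1)}$ for $1\le i\le n-1$, $1\le j\le\delta(i)$, further $C_1=\ddagger\,\#\,w_1$, $C_i=v_i\,\#\,w_i$ for $2\le i\le n-1$, $C_n=v_n\,\#\,\$$, and let $\mathcal T$ be the set of all these strings of length three. **Encoding.** Assign distinct bit strings of a common length to the letters of $V\cup W$. For $u\in V\cup W$ let $b(u)$ be obtained from the bit string of $u$ by applying the morphism $0\mapsto 01$, $1\mapsto 10$ and prepending $01000011$; let $\ell'$ be the common length of the strings $b(u)$, and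 let $\overline{b(u)}$ be $b(u)$ with all bits flipped. Let $\circ$ be a wildcard. For a character $i$ let $g_i$ be the morphism $0\mapsto\circ$, $1\mapsto i$, and let $$f_{L,i}(x)=g_i(b(x))\,g_i(\overline{b(x)})\,\circ^{\ell'},\qquad f_{M,i}(x)=g_i(\overline{b(x)})\,\circ^{\ell'}\,g_i(b(x)),\qquad f_{R,i}(x)=\circ^{\ell'}\,g_i(b(x))\,g_i(\overline{b(x)})$$ for $x \in V\cup W$, and $f_{L,i}(\ddagger)=f_{M,i}(\#)=f_{R,i}(\$)=i^{3\ell'}$. Let $\mathcal T'$ consist of the strings $f_{L,i}(x)f_{M,i}(y)f_{R,i}(z)$ for $xyz\in\mathcal T$, the strings $f_{M,i}(w_k)$ and $f_{L,i}(w_k)$ for $1\le k\le n-1$, and the strings $f_{M,i}(v_k)$ and $f_{R,i}(v_k)$ for $2\le k\le n$, where each of these strings is written with its own character $i$, and different strings have different characters. A string $S$ *occurs* in a string $Q$ with ending position $e$ if $|S|\le e\le |Q|$ and every non-wildcard character of $S$ equals the corresponding character of $Q[e-|S|+1..e]$ (so a wildcard of $Q$, if there is any, is matched only by a wildcard of $S$).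 **Lemma.** Let $Q$ be a string of length $(2m+3n)\cdot 3\ell'$ in which every string of $\mathcal T'$ occurs. Then every $S\in\mathcal T'$ has exactly one occurrence in $Q$, and this occurrence is block-aligned: its ending position is a multiple of $3\ell'$. -/

import Mathlib

namespace Soda

/-- An instance of the restricted directed Hamiltonian path problem on the vertex set `V`. -/
structure RDHP (V : Type*) where
  graph : Digraph V
  s : V
  t : V
  s_ne_t : s ≠ t
  no_in : ∀ u, ¬ graph.Adj u s
  no_out : ∀ u, ¬ graph.Adj t u
  two_out : ∀ u, u ≠ t → 1 < {x | graph.Adj u x}.ncard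

/-- The number `n` of nodes. -/
noncomputable def RDHP.n {V : Type*} (_P : RDHP V) : ℕ := Nat.card V

/-- The number `m` of edges. -/
noncomputable def RDHP.m {V : Type*} (P : RDHP V) : ℕ :=
  {e : V × V | P.graph.Adj e.1 e.2}.ncard

/-- An arbitrary ordering of the children of every node. -/
structure ChildOrder {V : Type*} (P : RDHP V) where
  children : V → List V
  nodup : ∀ u, (children u).Nodup
  mem_children : ∀ u x, x ∈ children u ↔ P.graph.Adj u x

namespace ChildOrder

variable {V : Type*} {P : RDHP V} (O : ChildOrder P)

/-- The out-degree `δ(u)`. -/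
def deg (u : V) : ℕ := (O.children u).length

/-- `c(u, j)`: the `((j mod δ(u)) + 1)`-th child of `u`
(the default value is only reached if `u` has no child). -/
def c (u : V) (j : ℕ) : V := (O.children u).getD (j % O.deg u) u

end ChildOrder

/-- The symbols `‡`, `#`, `$`, the nodes `v u`, and one additional letter `w u` per node
(the letter `w t` is never used). -/
inductive Sym (V : Type*) where
  | ddagger : Sym V
  | hash : Sym V
  | dollar : Sym V
  | v (u : V) : Sym V
  | w (u : V) : Sym V

/-- The set `V ∪ W`. -/
def letters {V : Type*} (P : RDHP V) : Set (Sym V) :=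
  {x | ∃ u, x = Sym.v u} ∪ {x | ∃ u, u ≠ P.t ∧ x = Sym.w u}

/-- Strings of length three over the symbols. -/
abbrev Triple (V : Type*) := Sym V × Sym V × Sym V

section Strings

variable {V : Type*} {P : RDHP V} (O : ChildOrder P)

def strA (i : V) (j : ℕ) : Triple V := (Sym.w i, Sym.v (O.c i j), Sym.w i)

def strB (i : V) (j : ℕ) : Triple V := (Sym.v (O.c i j), Sym.w i, Sym.v (O.c i (j + 1)))

/-- The set `𝒜_i`. -/
def setA (i : V) : Set (Triple V) :=
  {x | ∃ j ∈ Finset.Icc 1 (O.deg i), x = strA O i j ∨ x = strB O i j}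

/-- The set `𝒞`. -/
def setC (P : RDHP V) : Set (Triple V) :=
  {(Sym.ddagger, Sym.hash, Sym.w P.s), (Sym.v P.t, Sym.hash, Sym.dollar)} ∪
    {x | ∃ u, u ≠ P.s ∧ u ≠ P.t ∧ x = (Sym.v u, Sym.hash, Sym.w u)}

/-- The set `𝒯`. -/
def setT : Set (Triple V) := setC P ∪ {x | ∃ i, i ≠ P.t ∧ x ∈ setA O i}

end Strings

/-- Distinct bit strings of a common length `k` for the letters in `V ∪ W`. -/
structure BitCode {V : Type*} (P : RDHP V) where
  k : ℕ
  bits : Sym V → List Bool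
  length_bits : ∀ x ∈ letters P, (bits x).length = k
  injOn : Set.InjOn bits (letters P)

/-- The morphism `0 ↦ 01`, `1 ↦ 10`. -/
def phi (l : List Bool) : List Bool := l.flatMap fun b => [b, !b]

/-- `α = 01000011`. -/
def alpha : List Bool := [false, true, false, false, false, false, true, true]

/-- Flipping all bits. -/
def flip (l : List Bool) : List Bool := l.map fun b => !b

/-- Strings with wildcards: `none` is the wildcard `∘`, and `some i` is the character `i`. -/
abbrev WStr := List (Option ℕ)

/-- The morphism `0 ↦ ∘`, `1 ↦ i`. -/
def g (i : ℕ) (l : List Bool) : WStr := l.map fun b => if b then some i else none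

namespace BitCode

variable {V : Type*} {P : RDHP V} (E : BitCode P)

/-- The bit string `b(x)`, for `x` in `V ∪ W`. -/
def b (x : Sym V) : List Bool := alpha ++ phi (E.bits x)

/-- The common length `ℓ'` of the strings `b(x)`, for `x` in `V ∪ W`. -/
def len : ℕ := 8 + 2 * E.k

theorem length_b {x : Sym V} (hx : x ∈ letters P) : (E.b x).length = E.len := by
  have h : ∀ l : List Bool, (phi l).length = 2 * l.length := by
    intro l
    simp [phi, List.length_flatMap, mul_comm]
  simp [b, len, h, alpha, E.length_bits x hx]
  omega

def fL (i : ℕ) : Sym V → WStr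
  | Sym.ddagger => List.replicate (3 * E.len) (some i)
  | x => g i (E.b x) ++ g i (flip (E.b x)) ++ List.replicate E.len none

def fM (i : ℕ) : Sym V → WStr
  | Sym.hash => List.replicate (3 * E.len) (some i)
  | x => g i (flip (E.b x)) ++ List.replicate E.len none ++ g i (E.b x)

def fR (i : ℕ) : Sym V → WStr
  | Sym.dollar => List.replicate (3 * E.len) (some i)
  | x => List.replicate E.len none ++ g i (E.b x) ++ g i (flip (E.b x))

/-- The string `f(xyz)` with the character `i`. -/
def f (i : ℕ) (x : Triple V) : WStr := E.fL i x.1 ++ E.fM i x.2.1 ++ E.fR i x.2.2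

end BitCode

/-- Names of the input strings: `f(xyz)` and the patch strings `f_L(x)`, `f_M(x)`, `f_R(x)`. -/
inductive Name (V : Type*) where
  | main (x : Triple V) : Name V
  | patchL (x : Sym V) : Name V
  | patchM (x : Sym V) : Name V
  | patchR (x : Sym V) : Name V

/-- The names of the strings that make up `𝒯'`. -/
def names {V : Type*} {P : RDHP V} (O : ChildOrder P) : Set (Name V) :=
  {y | ∃ x ∈ setT O, y = Name.main x} ∪
  {y | ∃ u, u ≠ P.t ∧ (y = Name.patchM (Sym.w u) ∨ y = Name.patchL (Sym.w u))} ∪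
  {y | ∃ u, u ≠ P.s ∧ (y = Name.patchM (Sym.v u) ∨ y = Name.patchR (Sym.v u))}

/-- The string with a given name and character `i`. -/
def BitCode.str {V : Type*} {P : RDHP V} (E : BitCode P) (i : ℕ) : Name V → WStr
  | Name.main x => E.f i x
  | Name.patchL x => E.fL i x
  | Name.patchM x => E.fM i x
  | Name.patchR x => E.fR i x

/-- The set `𝒯'`, for an assignment `ι` of characters (IDs) to the input strings. -/
def setT' {V : Type*} {P : RDHP V} (O : ChildOrder P) (E : BitCode P) (ι : Name V → ℕ) :
    Set WStr :=
  {S | ∃ y ∈ names O, S = E.str (ι y) y}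

/-- The pattern `S` matches the text `T` of the same length: every position of `S` is a wildcard
or agrees with `T`. A wildcard of the text is an unfilled position, which only a wildcard of the
pattern matches. -/
def Matches (S T : WStr) : Prop := List.Forall₂ (fun x y => x = none ∨ x = y) S T

/-- `S` occurs in `Q` with ending position `e` (positions are counted from `1`). -/
def OccursEndingAt (S Q : WStr) (e : ℕ) : Prop :=
  S.length ≤ e ∧ e ≤ Q.length ∧ Matches S ((Q.take e).drop (e - S.length))

/-- `S` has a match in `Q`. -/
def HasMatch (S Q : WStr) : Prop := ∃ e, OccursEndingAt S Q e

end Soda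

/-!
The strings of `𝒯'` carry distinct characters, and together they have `|Q|` non-wildcards, so their
occurrences tile `Q`: each position is claimed by exactly one string. In particular the positions of
the character `i` in `Q` are exactly those of one occurrence of its string, which makes this
occurrence unique.

For the alignment to multiples of `ℓ'`, fill `Q` from left to right. The prefix `01000011` of the
code words leaves only two ways to continue at a multiple of `ℓ'`: a run without wildcards, or a
code word together with the flipped code word of the same letter. Hence `Q` splits into columns of
width `ℓ'`. Filling these from left to right in turn, every three columns hold either a run
`i ^ (3ℓ')` or the parts `f_L(x)`, `f_M(x)`, `f_R(x)` of one letter `x`.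

A middle part or a run thus starts at a multiple of `3ℓ'`, which aligns every string except the
patches `f_L(w)` and `f_R(v)`, whose parts could still exchange the roles of `f_L` and `f_R`. This
is excluded by counting: the `f_R(w)` that belong to strings of `𝒯` are as many as all `f_M(w)`, and
each of them shares its three columns with a different one of these, so no `f_L(w)` can play their
role. The same holds for `f_L(v)`, `f_M(v)` and the patches `f_R(v)`.
-/

namespace Soda

/-- The pieces of length `ℓ'` from which the input strings are composed: a run of wildcards,
the code word of a letter, its flipped version, or a run without wildcards. -/
inductive Piece (X : Type*) where
  | blank : Piece X
  | pos (x : X) : Piece X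
  | neg (x : X) : Piece X
  | full : Piece X

section Pieces

variable {X J : Type*} {b : X → ℕ → Bool} {l N : ℕ} {c : J → Piece X} {s : J → ℕ}

namespace Piece

/-- Whether a piece has a non-wildcard at offset `r`, where `b x r` is the `r`-th bit of the code
word of `x`. -/
def bit (b : X → ℕ → Bool) : Piece X → ℕ → Bool
  | blank, _ => false
  | pos x, r => b x r
  | neg x, r => !b x r
  | full, _ => true

/-- The offset of the first non-wildcard of a piece: code words start with `01`. -/
def lead : Piece X → ℕ
  | blank => 0
  | pos _ => 1
  | neg _ => 0
  | full => 0

/-- The positions of the non-wildcards of a piece of length `l` that is placed at position `s`. -/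
def occupied (b : X → ℕ → Bool) (l : ℕ) (c : Piece X) (s : ℕ) : Finset ℕ :=
  {r ∈ Finset.range l | c.bit b r = true}.map (addLeftEmbedding s)

theorem mem_occupied {c : Piece X} {s p : ℕ} :
    p ∈ c.occupied b l s ↔ ∃ r < l, c.bit b r = true ∧ s + r = p := by
  simp [occupied, and_assoc]

theorem add_mem_occupied {c : Piece X} {s r : ℕ} (hr : r < l) (h : c.bit b r = true) :
    s + r ∈ c.occupied b l s :=
  mem_occupied.2 ⟨r, hr, h, rfl⟩

theorem add_notMem_occupied {c : Piece X} {s r : ℕ} (h : c.bit b r = false) :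
    s + r ∉ c.occupied b l s := by
  rw [mem_occupied]
  rintro ⟨r', -, hr', heq⟩
  obtain rfl : r' = r := by omega
  exact Bool.false_ne_true (h.symm.trans hr')

theorem card_occupied (c : Piece X) (s : ℕ) :
    (c.occupied b l s).card = {r ∈ Finset.range l | c.bit b r = true}.card :=
  Finset.card_map _

theorem card_occupied_blank (s : ℕ) : ((blank : Piece X).occupied b l s).card = 0 := by
  simp [card_occupied, bit]

theorem card_occupied_full (s : ℕ) : ((full : Piece X).occupied b l s).card = l := by
  simp [card_occupied, bit]

theorem card_occupied_pos_add_neg (x : X) (s s' : ℕ) :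
    ((pos x).occupied b l s).card + ((neg x).occupied b l s').card = l := by
  have hneg (r : ℕ) : (neg x).bit b r = true ↔ ¬(pos x).bit b r = true := by simp [bit]
  simp only [card_occupied, hneg]
  rw [Finset.card_filter_add_card_filter_not, Finset.card_range]

end Piece

open Piece

/-- The code words `b x` of length `l` start with `alpha`, and none is dominated by another. -/
structure IsCode (b : X → ℕ → Bool) (l : ℕ) : Prop where
  length_alpha_le : alpha.length ≤ l
  eq_alpha : ∀ x, ∀ r < alpha.length, b x r = alpha.getD r false
  exists_lt : ∀ x y, x ≠ y → ∃ r < l, b x r = true ∧ b y r = false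

namespace IsCode

theorem eight_le (hb : IsCode b l) : 8 ≤ l := hb.length_alpha_le

theorem bit_pos (hb : IsCode b l) (x : X) {r : ℕ} (hr : r < 8) :
    (pos x).bit b r = alpha.getD r false :=
  hb.eq_alpha x r hr

theorem bit_neg (hb : IsCode b l) (x : X) {r : ℕ} (hr : r < 8) :
    (neg x).bit b r = !alpha.getD r false :=
  congrArg not (hb.eq_alpha x r hr)

theorem add_lead_mem_occupied (hb : IsCode b l) {c : Piece X} (hc : c ≠ .blank) (s : ℕ) :
    s + c.lead ∈ c.occupied b l s := by
  have h8 := hb.eight_le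
  refine add_mem_occupied (by cases c <;> simp only [lead] <;> omega) ?_
  cases c with
  | blank => exact absurd rfl hc
  | pos x => exact hb.bit_pos x (r := 1) (by decide)
  | neg x => exact hb.bit_neg x (r := 0) (by decide)
  | full => rfl

theorem add_lead_le (hb : IsCode b l) {c : Piece X} {s p : ℕ} (h : p ∈ c.occupied b l s) :
    s + c.lead ≤ p := by
  obtain ⟨r, -, hbit, rfl⟩ := mem_occupied.1 h
  cases c with
  | pos x =>
    have hr : r ≠ 0 := by
      rintro rfl
      exact Bool.false_ne_true ((hb.bit_pos x (by decide)).symm.trans hbit)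
    simp only [lead]
    omega
  | _ => simp [lead]

end IsCode

/-- The pieces `c j`, placed at the positions `s j`, occupy each of the positions `0, …, N - 1`
exactly once, and no other position. -/
structure IsTiling (b : X → ℕ → Bool) (l N : ℕ) (c : J → Piece X) (s : J → ℕ) : Prop where
  eq_of_mem : ∀ {i j p}, p ∈ (c i).occupied b l (s i) → p ∈ (c j).occupied b l (s j) → i = j
  lt_of_mem : ∀ {j p}, p ∈ (c j).occupied b l (s j) → p < N
  exists_mem : ∀ p < N, ∃ j, p ∈ (c j).occupied b l (s j)

theorem IsTiling.of_le_sum_card [Fintype J]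
    (heq : ∀ {i j p}, p ∈ (c i).occupied b l (s i) → p ∈ (c j).occupied b l (s j) → i = j)
    (hlt : ∀ {j p}, p ∈ (c j).occupied b l (s j) → p < N)
    (hN : N ≤ ∑ j, ((c j).occupied b l (s j)).card) : IsTiling b l N c s := by
  refine ⟨heq, hlt, fun p hp => ?_⟩
  have hdisj : Set.PairwiseDisjoint ((Finset.univ : Finset J) : Set J)
      fun j => (c j).occupied b l (s j) := fun i _ j _ hij =>
    Finset.disjoint_left.2 fun p hi hj => hij (heq hi hj)
  have hunion : Finset.univ.biUnion (fun j => (c j).occupied b l (s j)) = Finset.range N := by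
    refine Finset.eq_of_subset_of_card_le (fun p hp => ?_) ?_
    · obtain ⟨j, -, hj⟩ := Finset.mem_biUnion.1 hp
      exact Finset.mem_range.2 (hlt hj)
    · rwa [Finset.card_biUnion hdisj, Finset.card_range]
  obtain ⟨j, -, hj⟩ := Finset.mem_biUnion.1 (hunion ▸ Finset.mem_range.2 hp)
  exact ⟨j, hj⟩

/-- Every piece whose first non-wildcard stands before `p` is placed at a multiple of `l`. -/
def AlignedBelow (l : ℕ) (c : J → Piece X) (s : J → ℕ) (p : ℕ) : Prop :=
  ∀ j, c j ≠ .blank → s j + (c j).lead < p → l ∣ s j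

theorem ne_blank_of_mem_occupied {c : Piece X} {s p : ℕ} (h : p ∈ c.occupied b l s) :
    c ≠ .blank := by
  rintro rfl
  simp [mem_occupied, bit] at h

theorem AlignedBelow.le_add_lead {j : J} {k p : ℕ} (h : AlignedBelow l c s (k * l))
    (hp : p ∈ (c j).occupied b l (s j)) (hkp : k * l ≤ p) : k * l ≤ s j + (c j).lead := by
  by_contra! hlt
  obtain ⟨a, ha⟩ := h j (ne_blank_of_mem_occupied hp) hlt
  obtain ⟨r, hr, -, rfl⟩ := mem_occupied.1 hp
  have hak : a < k := lt_of_mul_lt_mul_right (a := l) (by rw [mul_comm a]; omega) (Nat.zero_le l)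
  have : (a + 1) * l ≤ k * l := Nat.mul_le_mul_right l hak
  rw [ha, mul_comm l a] at hkp
  linarith [Nat.succ_mul a l]

namespace IsTiling

theorem add_ne_add (hT : IsTiling b l N c s) {i j : J} (hij : i ≠ j) {r r' : ℕ} (hr : r < l)
    (hr' : r' < l) (hi : (c i).bit b r = true) (hj : (c j).bit b r' = true) :
    s i + r ≠ s j + r' := fun h =>
  hij (hT.eq_of_mem (add_mem_occupied hr hi) (h ▸ add_mem_occupied hr' hj))

theorem exists_lead_eq (hT : IsTiling b l N c s) (hb : IsCode b l) {k : ℕ}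
    (hk : AlignedBelow l c s (k * l)) (hkN : k * l + 1 < N) {j : J}
    (hj : k * l ∈ (c j).occupied b l (s j)) (hj' : k * l + 1 ∉ (c j).occupied b l (s j)) :
    ∃ i ≠ j, c i ≠ .blank ∧ s i + (c i).lead = k * l + 1 := by
  obtain ⟨i, hi⟩ := hT.exists_mem (k * l + 1) hkN
  have hij : i ≠ j := fun h => hj' (h ▸ hi)
  have hne := ne_blank_of_mem_occupied hi
  have hlow := hk.le_add_lead hi (by omega)
  have hupp := hb.add_lead_le hi
  have hstart : s i + (c i).lead ≠ k * l := fun h =>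
    hij (hT.eq_of_mem (hb.add_lead_mem_occupied hne (s i)) (h ▸ hj))
  exact ⟨i, hij, hne, by omega⟩

/-- A code word `01000011…` placed one position too early would leave position `k * l + 1` to
another piece, whose first eight bits collide with the `11` of this prefix. -/
theorem pos_add_one_ne (hT : IsTiling b l N c s) (hb : IsCode b l) {k : ℕ}
    (hk : AlignedBelow l c s (k * l)) (hkN : k * l + l ≤ N) {j : J} {x : X} (hj : c j = .pos x) :
    s j + 1 ≠ k * l := by
  intro hjk
  have h8 := hb.eight_le
  have bit_j {r : ℕ} (hr : r < 8) : (c j).bit b r = alpha.getD r false := by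
    rw [hj, hb.bit_pos x hr]
  obtain ⟨i, hij, hne, hlead⟩ := hT.exists_lead_eq hb hk (by omega) (j := j)
    (hjk ▸ add_mem_occupied (by omega) (bit_j (by decide)))
    (hjk ▸ add_notMem_occupied (r := 2) (bit_j (by decide)))
  cases hci : c i with
  | blank => exact hne hci
  | pos y =>
    rw [hci, lead] at hlead
    exact hT.add_ne_add hij (by omega) (by omega) (r := 6) (r' := 7)
      (hci ▸ hb.bit_pos y (by decide)) (bit_j (by decide)) (by omega)
  | neg y =>
    rw [hci, lead] at hlead
    exact hT.add_ne_add hij (by omega) (by omega) (r := 4) (r' := 6)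
      (hci ▸ hb.bit_neg y (by decide)) (bit_j (by decide)) (by omega)
  | full =>
    rw [hci, lead] at hlead
    exact hT.add_ne_add hij (by omega) (by omega) (r := 4) (r' := 6)
      (by rw [hci, bit]) (bit_j (by decide)) (by omega)

/-- The piece after a flipped code word `10111100…` fills its gaps: anything but the code word of
the same letter would collide with it. -/
theorem exists_pos_of_neg (hT : IsTiling b l N c s) (hb : IsCode b l) {k : ℕ}
    (hk : AlignedBelow l c s (k * l)) (hkN : k * l + l ≤ N) {j : J} {x : X} (hj : c j = .neg x)
    (hjk : s j = k * l) : ∃ i, c i = .pos x ∧ s i = k * l := by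
  have h8 := hb.eight_le
  have bit_j {r : ℕ} (hr : r < 8) : (c j).bit b r = !alpha.getD r false := by
    rw [hj, hb.bit_neg x hr]
  obtain ⟨i, hij, hne, hlead⟩ := hT.exists_lead_eq hb hk (by omega) (j := j)
    (hjk ▸ add_mem_occupied (r := 0) (by omega) (bit_j (by decide)))
    (hjk ▸ add_notMem_occupied (bit_j (by decide)))
  cases hci : c i with
  | blank => exact absurd hci hne
  | pos y =>
    rw [hci, lead] at hlead
    have hxy : y = x := by
      by_contra hyx
      obtain ⟨r, hr, hy, hx⟩ := hb.exists_lt y x hyx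
      exact hT.add_ne_add hij hr hr (by rw [hci, bit, hy]) (by rw [hj, bit, hx]; rfl) (by omega)
    exact ⟨i, hci.trans (congrArg pos hxy), by omega⟩
  | neg y =>
    rw [hci, lead] at hlead
    exact absurd (by omega) (hT.add_ne_add hij (by omega) (by omega) (r := 3) (r' := 4)
      (hci ▸ hb.bit_neg y (by decide)) (bit_j (by decide)))
  | full =>
    rw [hci, lead] at hlead
    exact absurd (by omega) (hT.add_ne_add hij (by omega) (by omega) (r := 3) (r' := 4)
      (by rw [hci, bit]) (bit_j (by decide)))

theorem exists_column (hT : IsTiling b l N c s) (hb : IsCode b l) {k : ℕ}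
    (hk : AlignedBelow l c s (k * l)) (hkN : k * l + l ≤ N) :
    (∃ j, c j = .full ∧ s j = k * l) ∨
      ∃ x i j, (c i = .pos x ∧ s i = k * l) ∧ c j = .neg x ∧ s j = k * l := by
  have h8 := hb.eight_le
  obtain ⟨j, hj⟩ := hT.exists_mem (k * l) (by omega)
  have hlead := (hb.add_lead_le hj).antisymm (hk.le_add_lead hj le_rfl)
  cases hcj : c j with
  | blank => exact absurd hcj (ne_blank_of_mem_occupied hj)
  | pos x => exact absurd (by rwa [hcj] at hlead) (hT.pos_add_one_ne hb hk hkN hcj)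
  | full => exact .inl ⟨j, hcj, by rwa [hcj] at hlead⟩
  | neg x =>
    have hjk : s j = k * l := by rwa [hcj] at hlead
    obtain ⟨i, hi⟩ := hT.exists_pos_of_neg hb hk hkN hcj hjk
    exact .inr ⟨x, i, j, hi, hcj, hjk⟩

theorem exists_mem_column (hT : IsTiling b l N c s) (hb : IsCode b l) {k : ℕ}
    (hk : AlignedBelow l c s (k * l)) (hkN : k * l + l ≤ N) {r : ℕ} (hr : r < l) :
    ∃ j, s j = k * l ∧ k * l + r ∈ (c j).occupied b l (s j) := by
  obtain ⟨j, hj, hs⟩ | ⟨x, i, j, ⟨hi, hsi⟩, hj, hsj⟩ := hT.exists_column hb hk hkN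
  · exact ⟨j, hs, hs ▸ add_mem_occupied hr (by rw [hj, bit])⟩
  · cases hx : b x r with
    | true => exact ⟨i, hsi, hsi ▸ add_mem_occupied hr (by rw [hi, bit, hx])⟩
    | false => exact ⟨j, hsj, hsj ▸ add_mem_occupied hr (by rw [hj, bit, hx]; rfl)⟩

theorem alignedBelow {n : ℕ} (hT : IsTiling b l (n * l) c s) (hb : IsCode b l) {k : ℕ}
    (hkn : k ≤ n) : AlignedBelow l c s (k * l) := by
  induction k with
  | zero => exact fun j _ h => absurd h (by omega)
  | succ k ih =>
    have hk := ih (by omega)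
    have hle : k * l + l ≤ n * l := k.succ_mul l ▸ Nat.mul_le_mul_right l hkn
    intro j hj hlt
    obtain h | h := lt_or_ge (s j + (c j).lead) (k * l)
    · exact hk j hj h
    · obtain ⟨r, hr⟩ := Nat.exists_eq_add_of_le h
      obtain ⟨i, hi, hmem⟩ := hT.exists_mem_column hb hk hle (r := r) (by linarith [k.succ_mul l])
      obtain rfl := hT.eq_of_mem hmem (hr ▸ hb.add_lead_mem_occupied hj (s j))
      exact ⟨k, hi.trans (mul_comm k l)⟩

theorem dvd {n : ℕ} (hT : IsTiling b l (n * l) c s) (hb : IsCode b l) {j : J}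
    (hj : c j ≠ .blank) : l ∣ s j :=
  hT.alignedBelow hb le_rfl j hj (hT.lt_of_mem (hb.add_lead_mem_occupied hj (s j)))

end IsTiling

end Pieces

/-- The strings `f_L(x)`, `f_M(x)`, `f_R(x)` and `i ^ (3ℓ')` stripped of leading wildcards: both
`f_L(x)` and `f_R(x)` become `forward x`, a code word followed by its flipped version. -/
inductive Tile (X : Type*) where
  | blank : Tile X
  | forward (x : X) : Tile X
  | middle (x : X) : Tile X
  | full : Tile X

namespace Tile

variable {X : Type*}

/-- The three consecutive pieces of a tile. -/
def piece : Tile X → Fin 3 → Piece X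
  | blank => ![.blank, .blank, .blank]
  | forward x => ![.pos x, .neg x, .blank]
  | middle x => ![.neg x, .blank, .pos x]
  | full => ![.full, .full, .full]

/-- The number of columns that a tile spans. -/
def width : Tile X → ℕ
  | blank => 0
  | forward _ => 2
  | middle _ => 3
  | full => 3

/-- The number of non-wildcards of a tile in units of the length of a piece. -/
def area : Tile X → ℕ
  | blank => 0
  | forward _ => 1
  | middle _ => 1
  | full => 3

theorem sum_card_occupied (b : X → ℕ → Bool) (l : ℕ) (T : Tile X) (s : Fin 3 → ℕ) :
    ∑ a, ((T.piece a).occupied b l (s a)).card = T.area * l := by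
  rw [Fin.sum_univ_three]
  cases T with
  | blank => simp [piece, area, Piece.card_occupied_blank]
  | forward x =>
    simp [piece, area, Piece.card_occupied_blank, Piece.card_occupied_pos_add_neg]
  | middle x =>
    simpa [piece, area, Piece.card_occupied_blank, add_comm] using
      Piece.card_occupied_pos_add_neg x (s 2) (s 0)
  | full =>
    simp only [piece, area, Matrix.cons_val, Piece.card_occupied_full]
    ring

theorem piece_zero_ne_blank {T : Tile X} (hT : T ≠ .blank) : T.piece 0 ≠ .blank := by
  cases T with
  | blank => exact absurd rfl hT
  | _ => exact nofun

end Tile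

section Tiles

variable {X I : Type*} {T : I → Tile X} {u : I → ℕ} {n : ℕ}

/-- The tile `T i`, placed with its first piece in column `u i`, has the piece `p` in column `q`. -/
def PieceAt (T : I → Tile X) (u : I → ℕ) (i : I) (q : ℕ) (p : Piece X) : Prop :=
  ∃ a : Fin 3, u i + a = q ∧ (T i).piece a = p

theorem pieceAt_pos {i : I} {q : ℕ} {x : X} :
    PieceAt T u i q (.pos x) ↔ T i = .forward x ∧ u i = q ∨ T i = .middle x ∧ u i + 2 = q := by
  cases h : T i <;> simp [PieceAt, h, Fin.exists_fin_succ, Tile.piece, and_comm]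

theorem pieceAt_neg {i : I} {q : ℕ} {x : X} :
    PieceAt T u i q (.neg x) ↔ T i = .middle x ∧ u i = q ∨ T i = .forward x ∧ u i + 1 = q := by
  cases h : T i <;> simp [PieceAt, h, Fin.exists_fin_succ, Tile.piece, and_comm]

theorem pieceAt_full {i : I} {q : ℕ} :
    PieceAt T u i q .full ↔ T i = .full ∧ u i ≤ q ∧ q < u i + 3 := by
  cases h : T i <;> simp [PieceAt, h, Fin.exists_fin_succ, Tile.piece]
  omega

/-- The tiles `T i`, placed at the columns `u i`, fill each of the columns `0, …, n - 1` exactly,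
either by a piece without wildcards or by a code word and its flipped version. -/
structure IsColumnTiling (n : ℕ) (T : I → Tile X) (u : I → ℕ) : Prop where
  eq_of_pos : ∀ {i j q x y}, PieceAt T u i q (.pos x) → PieceAt T u j q (.pos y) → i = j
  eq_of_neg : ∀ {i j q x y}, PieceAt T u i q (.neg x) → PieceAt T u j q (.neg y) → i = j
  eq_of_full : ∀ {i j q p}, PieceAt T u i q .full → PieceAt T u j q p → p ≠ .blank → i = j
  lt : ∀ {i}, T i ≠ .blank → u i < n
  exists_pieceAt : ∀ q < n, (∃ i, PieceAt T u i q .full) ∨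
    ∃ x i j, PieceAt T u i q (.pos x) ∧ PieceAt T u j q (.neg x)

theorem IsTiling.isColumnTiling {b : X → ℕ → Bool} {l : ℕ} (hb : IsCode b l)
    (hT : IsTiling b l (n * l) (fun p : I × Fin 3 => (T p.1).piece p.2)
      fun p => (u p.1 + p.2) * l) : IsColumnTiling n T u := by
  have h8 := hb.eight_le
  have heq {i j : I} {q : ℕ} {p p' : Piece X} (hi : PieceAt T u i q p) (hj : PieceAt T u j q p')
      {r : ℕ} (hr : r < l) (hp : p.bit b r = true) (hp' : p'.bit b r = true) : i = j := by
    obtain ⟨a, rfl, rfl⟩ := hi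
    obtain ⟨a', ha', rfl⟩ := hj
    have hmem : (u i + a) * l + r ∈ ((T j).piece a').occupied b l ((u j + a') * l) :=
      ha' ▸ Piece.add_mem_occupied hr hp'
    exact congrArg Prod.fst
      (hT.eq_of_mem (i := (i, a)) (j := (j, a')) (Piece.add_mem_occupied hr hp) hmem)
  have hcell (i : I) (a : Fin 3) (q : ℕ) (h : (u i + a) * l = q * l) :
      PieceAt T u i q ((T i).piece a) := ⟨a, Nat.eq_of_mul_eq_mul_right (by omega) h, rfl⟩
  refine ⟨fun hi hj => heq hi hj (r := 1) (by omega) (hb.bit_pos _ (by decide))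
      (hb.bit_pos _ (by decide)), fun hi hj => heq hi hj (r := 0) (by omega)
      (hb.bit_neg _ (by decide)) (hb.bit_neg _ (by decide)), ?_, ?_, ?_⟩
  · intro i j q p hi hj hp
    obtain ⟨r, hr, hbit, -⟩ := Piece.mem_occupied.1 (hb.add_lead_mem_occupied hp 0)
    exact heq hi hj hr rfl hbit
  · intro i hi
    have hlt : (u i + 0) * l + ((T i).piece 0).lead < n * l :=
      hT.lt_of_mem (j := (i, 0)) (hb.add_lead_mem_occupied (Tile.piece_zero_ne_blank hi) _)
    exact lt_of_mul_lt_mul_right (a := l) ((Nat.le_add_right _ _).trans_lt hlt) (Nat.zero_le l)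
  · intro q hq
    have hqn : q * l + l ≤ n * l := q.succ_mul l ▸ Nat.mul_le_mul_right l hq
    obtain ⟨⟨i, a⟩, hi, hs⟩ | ⟨x, ⟨i, a⟩, ⟨j, a'⟩, ⟨hi, hsi⟩, hj, hsj⟩ :=
      hT.exists_column hb (hT.alignedBelow hb hq.le) hqn
    · exact .inl ⟨i, hi ▸ hcell i a q hs⟩
    · exact .inr ⟨x, i, j, hi ▸ hcell i a q hsi, hj ▸ hcell j a' q hsj⟩

/-- No tile reaches across the boundary between the columns `m - 1` and `m`. -/
def Separates (T : I → Tile X) (u : I → ℕ) (m : ℕ) : Prop :=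
  ∀ i, T i ≠ .blank → u i < m → u i + (T i).width ≤ m

/-- The columns `3k`, `3k + 1`, `3k + 2` are filled by one tile without wildcards or by the strings
`f_L(x)`, `f_M(x)`, `f_R(x)` of one letter, placed at column `3k`. -/
def IsFilled (T : I → Tile X) (u : I → ℕ) (k : ℕ) : Prop :=
  (∃ i, T i = .full ∧ u i = 3 * k) ∨
    ∃ x i j h, (T i = .middle x ∧ u i = 3 * k) ∧ (T j = .forward x ∧ u j = 3 * k) ∧
      T h = .forward x ∧ u h = 3 * k + 1

namespace Separates

theorem add_width_le_of_eq {m : ℕ} (hm : Separates T u m) {i : I} {S : Tile X} (hi : T i = S)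
    (hS : S ≠ .blank) (h : u i < m) : u i + S.width ≤ m := hi ▸ hm i (hi ▸ hS) h

theorem forward_of_pos {m q : ℕ} (hm : Separates T u m) {i : I} {x : X} (hmq : m ≤ q)
    (hq : q ≤ m + 1) (hi : PieceAt T u i q (.pos x)) : T i = .forward x ∧ u i = q := by
  obtain h | ⟨hi', rfl⟩ := pieceAt_pos.1 hi
  · exact h
  · have := hm.add_width_le_of_eq hi' nofun (by omega)
    simp only [Tile.width] at this
    omega

theorem middle_of_neg {m : ℕ} (hm : Separates T u m) {i : I} {x : X}
    (hi : PieceAt T u i m (.neg x)) : T i = .middle x ∧ u i = m := by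
  obtain h | ⟨hi', rfl⟩ := pieceAt_neg.1 hi
  · exact h
  · have := hm.add_width_le_of_eq hi' nofun (by omega)
    simp only [Tile.width] at this
    omega

theorem full_of_full {m : ℕ} (hm : Separates T u m) {i : I}
    (hi : PieceAt T u i m .full) : T i = .full ∧ u i = m := by
  obtain ⟨hi, hle, hlt⟩ := pieceAt_full.1 hi
  have := hm.add_width_le_of_eq hi nofun
  simp only [Tile.width] at this
  exact ⟨hi, by omega⟩

theorem isFilled {k : ℕ} (hk : Separates T u (3 * k)) (hT : IsColumnTiling n T u)
    (hkn : 3 * k + 1 < n) : IsFilled T u k := by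
  obtain ⟨i, hi⟩ | ⟨x, j, i, hj, hi⟩ := hT.exists_pieceAt (3 * k) (by omega)
  · exact .inl ⟨i, hk.full_of_full hi⟩
  have hj := hk.forward_of_pos le_rfl (by omega) hj
  have hneg : PieceAt T u j (3 * k + 1) (.neg x) := pieceAt_neg.2 (.inr ⟨hj.1, by omega⟩)
  obtain ⟨h, hh⟩ | ⟨y, h, j', hh, hj'⟩ := hT.exists_pieceAt (3 * k + 1) hkn
  · obtain rfl := hT.eq_of_full hh hneg nofun
    exact absurd (hj.1.symm.trans (pieceAt_full.1 hh).1) nofun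
  · obtain rfl := hT.eq_of_neg hneg hj'
    obtain ⟨hh, hu⟩ := hk.forward_of_pos (by omega) le_rfl hh
    obtain ⟨hm, -⟩ | ⟨hf, -⟩ := pieceAt_neg.1 hj'
    · exact absurd (hj.1.symm.trans hm) nofun
    · obtain rfl : x = y := Tile.forward.inj (hj.1.symm.trans hf)
      exact .inr ⟨x, i, j, h, hk.middle_of_neg hi, hj, hh, hu⟩

end Separates

theorem IsColumnTiling.eq_or_eq (hT : IsColumnTiling n T u) {q : ℕ} {x y : X} {i j h : I}
    (hj : PieceAt T u j q (.pos x)) (hh : PieceAt T u h q (.neg y)) {p : Piece X}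
    (hi : PieceAt T u i q p) (hp : p ≠ .blank) : i = j ∨ i = h := by
  cases p with
  | blank => exact absurd rfl hp
  | pos z => exact .inl (hT.eq_of_pos hi hj)
  | neg z => exact .inr (hT.eq_of_neg hi hh)
  | full => exact .inl (hT.eq_of_full hi hj nofun)

theorem IsFilled.add_width_le (hT : IsColumnTiling n T u) {k : ℕ} (hk : IsFilled T u k) {i : I}
    (hi : T i ≠ .blank) (hki : 3 * k ≤ u i) (hik : u i < 3 * k + 3) :
    u i + (T i).width ≤ 3 * k + 3 := by
  have hpiece : PieceAt T u i (u i) ((T i).piece 0) := ⟨0, rfl, rfl⟩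
  have hne := Tile.piece_zero_ne_blank hi
  obtain ⟨j, hj, hu⟩ | ⟨x, j₀, j₁, j₂, ⟨h₀, hu₀⟩, ⟨h₁, hu₁⟩, h₂, hu₂⟩ := hk
  · obtain rfl := hT.eq_of_full (pieceAt_full.2 ⟨hj, by omega, by omega⟩) hpiece hne
    simp only [hj, Tile.width, hu, le_refl]
  have hwidth : (T j₀).width = 3 ∧ (T j₁).width = 2 ∧ (T j₂).width = 2 := by
    simp only [h₀, h₁, h₂, Tile.width, and_self]
  have hcol : u i = 3 * k ∨ u i = 3 * k + 1 ∨ u i = 3 * k + 2 := by omega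
  obtain h | h | h := hcol
  · obtain rfl | rfl := hT.eq_or_eq (pieceAt_pos.2 (.inl ⟨h₁, by omega⟩))
      (pieceAt_neg.2 (.inl ⟨h₀, by omega⟩)) hpiece hne <;> omega
  · obtain rfl | rfl := hT.eq_or_eq (pieceAt_pos.2 (.inl ⟨h₂, by omega⟩))
      (pieceAt_neg.2 (.inr ⟨h₁, by omega⟩)) hpiece hne <;> omega
  · obtain rfl | rfl := hT.eq_or_eq (pieceAt_pos.2 (.inr ⟨h₀, by omega⟩))
      (pieceAt_neg.2 (.inr ⟨h₂, by omega⟩)) hpiece hne <;> omega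

namespace IsColumnTiling

variable {K : ℕ}

theorem separates (hT : IsColumnTiling (3 * K) T u) {k : ℕ} (hk : k ≤ K) :
    Separates T u (3 * k) := by
  induction k with
  | zero => exact fun i _ h => absurd h (by omega)
  | succ k ih =>
    have hsep := ih (by omega)
    intro i hi hlt
    obtain h | h := lt_or_ge (u i) (3 * k)
    · exact (hsep i hi h).trans (by omega)
    · exact (hsep.isFilled hT (by omega)).add_width_le hT hi h hlt

theorem isFilled (hT : IsColumnTiling (3 * K) T u) {k : ℕ} (hk : k < K) : IsFilled T u k :=
  (hT.separates hk.le).isFilled hT (by omega)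

theorem mod_three_add_width_le (hT : IsColumnTiling (3 * K) T u) {i : I} (hi : T i ≠ .blank) :
    u i % 3 + (T i).width ≤ 3 := by
  have hlt := hT.lt hi
  have := hT.separates (k := u i / 3 + 1) (by omega) i hi (by omega)
  omega

theorem exists_middle_of_forward (hT : IsColumnTiling (3 * K) T u) {i : I} {x : X}
    (hi : T i = .forward x) : ∃ j, T j = .middle x ∧ u j = 3 * (u i / 3) := by
  have hlt := hT.lt (hi ▸ nofun : T i ≠ .blank)
  have hwidth := hT.mod_three_add_width_le (hi ▸ nofun : T i ≠ .blank)
  rw [hi, Tile.width] at hwidth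
  have hpos : PieceAt T u i (u i) (.pos x) := pieceAt_pos.2 (.inl ⟨hi, rfl⟩)
  obtain ⟨j, hj⟩ | ⟨y, j, j₁, j₂, hj, h₁, h₂⟩ := hT.isFilled (k := u i / 3) (by omega)
  · obtain rfl := hT.eq_of_full (pieceAt_full.2 ⟨hj.1, by omega, by omega⟩) hpos nofun
    exact absurd (hi.symm.trans hj.1) nofun
  · have hij : i = j₁ ∨ i = j₂ := by
      obtain h | h : u i = 3 * (u i / 3) ∨ u i = 3 * (u i / 3) + 1 := by omega
      · exact .inl (hT.eq_of_pos hpos (pieceAt_pos.2 (.inl ⟨h₁.1, by omega⟩)))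
      · exact .inr (hT.eq_of_pos hpos (pieceAt_pos.2 (.inl ⟨h₂.1, by omega⟩)))
    obtain rfl : x = y := by
      obtain rfl | rfl := hij
      · exact Tile.forward.inj (hi.symm.trans h₁.1)
      · exact Tile.forward.inj (hi.symm.trans h₂.1)
    exact ⟨j, hj⟩

/-- Every `f_L(x)` with its first piece in phase `r` modulo `3` shares its block with a different
`f_M(x)`, so there are at most as many of the former as of the latter. -/
theorem mem_range_forward {M : Type*} [Finite M] (hT : IsColumnTiling (3 * K) T u)
    {fwd mid : M → I} {Z : Set X} {r : ℕ} (hinj : Function.Injective fwd)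
    (hfwd : ∀ m, ∃ x ∈ Z, T (fwd m) = .forward x ∧ u (fwd m) % 3 = r)
    (hmid : ∀ i, ∀ x ∈ Z, T i = .middle x → i ∈ Set.range mid) {i : I} {x : X} (hx : x ∈ Z)
    (hi : T i = .forward x) (hir : u i % 3 = r) : i ∈ Set.range fwd := by
  let F : Type _ := {i : I // ∃ x ∈ Z, T i = .forward x ∧ u i % 3 = r}
  have hpartner (i : F) : ∃ m, u (mid m) = 3 * (u i.1 / 3) := by
    obtain ⟨i, x, hx, hi, -⟩ := i
    obtain ⟨j, hj, hu⟩ := hT.exists_middle_of_forward hi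
    obtain ⟨m, rfl⟩ := hmid j x hx hj
    exact ⟨m, hu⟩
  choose partner hpartner using hpartner
  have partner_injective : Function.Injective partner := by
    rintro ⟨i, x, hx, hi, hir⟩ ⟨j, y, hy, hj, hjr⟩ h
    have hu : 3 * (u i / 3) = 3 * (u j / 3) :=
      (hpartner _).symm.trans ((congrArg (u ∘ mid) h).trans (hpartner _))
    exact Subtype.ext (hT.eq_of_pos (pieceAt_pos.2 (.inl ⟨hi, rfl⟩))
      (pieceAt_pos.2 (.inl ⟨hj, (by omega : u j = u i)⟩)))
  let fwdF (m : M) : F := ⟨fwd m, hfwd m⟩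
  have hsurj : Function.Surjective (partner ∘ fwdF) := Finite.surjective_of_injective <|
    partner_injective.comp fun m m' h => hinj (congrArg Subtype.val h)
  obtain ⟨m, hm⟩ := hsurj (partner ⟨i, x, hx, hi, hir⟩)
  exact ⟨m, congrArg Subtype.val (partner_injective hm)⟩

end IsColumnTiling

end Tiles

theorem eq_of_forall_add_eq {α : Type*} [AddCommMonoid α] [LinearOrder α]
    [IsOrderedCancelAddMonoid α] {D : Set α} (hfin : D.Finite) (hne : D.Nonempty) {p q : α}
    (h : ∀ d ∈ D, ∃ d' ∈ D, q + d' = p + d) : p = q := by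
  obtain ⟨d, hd, hmin⟩ := Set.exists_min_image D id hfin hne
  obtain ⟨e, he, hmax⟩ := Set.exists_max_image D id hfin hne
  obtain ⟨d', hd', hdd'⟩ := h d hd
  obtain ⟨e', he', hee'⟩ := h e he
  refine le_antisymm (le_of_add_le_add_right (a := e) ?_) (le_of_add_le_add_right (a := d) ?_)
  · exact hee' ▸ add_le_add_right (hmax e' he') q
  · exact hdd' ▸ add_le_add_right (hmin d' hd') q

/-- All characters of `A` other than wildcards appear in `S` when `A` is placed at position `p`. -/
def Fits (A S : WStr) (p : ℕ) : Prop := ∀ d i, A[d]? = some (some i) → S[p + d]? = some (some i)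

namespace Fits

variable {A B S : WStr} {p q : ℕ}

theorem trans (hAB : Fits A B p) (hBS : Fits B S q) : Fits A S (q + p) := fun d i h => by
  rw [add_assoc]
  exact hBS _ i (hAB d i h)

theorem prefix_append (A B : WStr) : Fits A (A ++ B) 0 := fun d i h => by
  obtain ⟨hd, -⟩ := List.getElem?_eq_some_iff.1 h
  rwa [zero_add, List.getElem?_append_left hd]

theorem suffix_append (A B : WStr) : Fits B (A ++ B) A.length := fun d i h => by
  rwa [List.getElem?_append_right (Nat.le_add_right _ _), Nat.add_sub_cancel_left]

theorem append_left (C : WStr) (h : Fits A S p) : Fits A (S ++ C) p := by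
  simpa only [zero_add] using h.trans (prefix_append S C)

theorem append_three {C : Fin 3 → WStr} {n : ℕ} (hC : ∀ j, (C j).length = n) (j : Fin 3) :
    Fits (C j) (C 0 ++ C 1 ++ C 2) (j * n) := by
  fin_cases j
  · simpa using (prefix_append (C 0) (C 1)).append_left (C 2)
  · simpa [hC] using (suffix_append (C 0) (C 1)).append_left (C 2)
  · simpa [hC, two_mul] using suffix_append (C 0 ++ C 1) (C 2)

theorem append_replicate_none (n : ℕ) (h : Fits A S p) :
    Fits (A ++ List.replicate n none) S p := fun d i hd => by
  rw [List.getElem?_append] at hd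
  split_ifs at hd with hlt
  · exact h d i hd
  · simp [List.getElem?_replicate] at hd

end Fits

theorem OccursEndingAt.fits {S Q : WStr} {e : ℕ} (h : OccursEndingAt S Q e) :
    Fits S Q (e - S.length) := by
  intro d i hd
  obtain ⟨-, -, hmatch⟩ := h
  obtain ⟨hdS, hdi⟩ := List.getElem?_eq_some_iff.1 hd
  have hdT := hmatch.length_eq ▸ hdS
  have hchar := (List.forall₂_iff_get.1 hmatch).2 d hdS hdT
  simp only [List.get_eq_getElem, hdi, reduceCtorEq, false_or] at hchar
  have htake := (List.getElem?_eq_getElem hdT).trans (congrArg some hchar.symm)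
  rw [List.getElem?_drop, List.getElem?_take] at htake
  split_ifs at htake
  exact htake

section Letters

variable {V : Type*} {P : RDHP V}

theorem phi_getD (l : List Bool) (j : ℕ) (hj : j < l.length) :
    (phi l).getD (2 * j) false = l[j] ∧ (phi l).getD (2 * j + 1) false = !l[j] := by
  induction l generalizing j with
  | nil => exact absurd hj (Nat.not_lt_zero j)
  | cons a l ih =>
    cases j with
    | zero => simp [phi]
    | succ j => simpa [phi, Nat.mul_succ] using ih j (by simpa using hj)

namespace BitCode

variable (E : BitCode P)

/-- The `r`-th bit of `b(x)`. -/
def bitAt (x : letters P) (r : ℕ) : Bool := (E.b x).getD r false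

theorem bitAt_eight_add (x : letters P) (r : ℕ) :
    E.bitAt x (8 + r) = (phi (E.bits x)).getD r false := by
  simp [bitAt, b, alpha, add_comm 8 r]

theorem isCode : IsCode E.bitAt E.len := by
  refine ⟨by simp [len, alpha], fun x r hr => ?_, fun x y hxy => ?_⟩
  · rw [bitAt, b, List.getD_append _ _ _ _ hr]
  have hlen : (E.bits x).length = (E.bits y).length :=
    (E.length_bits x x.2).trans (E.length_bits y y.2).symm
  obtain ⟨j, hjx, hjy, hj⟩ : ∃ (j : ℕ) (hx : j < (E.bits x).length) (hy : j < (E.bits y).length),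
      (E.bits x)[j] ≠ (E.bits y)[j] := by
    by_contra! hall
    exact hxy (Subtype.ext (E.injOn x.2 y.2 (List.ext_getElem hlen hall)))
  have hjk := E.length_bits x x.2 ▸ hjx
  obtain ⟨hx, hx'⟩ := phi_getD _ j hjx
  obtain ⟨hy, hy'⟩ := phi_getD _ j hjy
  cases hv : (E.bits x)[j] with
  | true =>
    refine ⟨8 + 2 * j, by rw [len]; omega, ?_, ?_⟩
    · rw [bitAt_eight_add, hx, hv]
    · rw [bitAt_eight_add, hy]
      exact Bool.eq_false_iff.2 (hv ▸ hj.symm)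
  | false =>
    refine ⟨8 + (2 * j + 1), by rw [len]; omega, ?_, ?_⟩
    · rw [bitAt_eight_add, hx', hv]; rfl
    · rw [bitAt_eight_add, hy', Bool.not_eq_false']
      exact Bool.ne_false_iff.1 (hv ▸ hj.symm)

/-- A piece as a string of length `ℓ'`, written with the character `i`. -/
def renderPiece (i : ℕ) (p : Piece (letters P)) : WStr :=
  (List.range E.len).map fun r => if p.bit E.bitAt r = true then some i else none

/-- A tile as a string of length `3ℓ'`, written with the character `i`. -/
def renderTile (i : ℕ) (T : Tile (letters P)) : WStr :=
  E.renderPiece i (T.piece 0) ++ E.renderPiece i (T.piece 1) ++ E.renderPiece i (T.piece 2)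

variable {E}

@[simp]
theorem length_renderPiece (i : ℕ) (p : Piece (letters P)) :
    (E.renderPiece i p).length = E.len := by
  simp [renderPiece]

theorem renderPiece_getElem? (i : ℕ) {p : Piece (letters P)} {r : ℕ} (hr : r < E.len)
    (hp : p.bit E.bitAt r = true) : (E.renderPiece i p)[r]? = some (some i) := by
  simp [renderPiece, hr, hp]

theorem renderPiece_blank (i : ℕ) : E.renderPiece i .blank = List.replicate E.len none := by
  simp [renderPiece, Piece.bit]

theorem renderPiece_full (i : ℕ) : E.renderPiece i .full = List.replicate E.len (some i) := by
  simp [renderPiece, Piece.bit]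

theorem renderPiece_pos (i : ℕ) (x : letters P) : E.renderPiece i (.pos x) = g i (E.b x) := by
  refine List.ext_getElem (by simp [g, E.length_b x.2]) fun r hr hr' => ?_
  have hrb : r < (E.b x).length := by simpa [g] using hr'
  simp [renderPiece, g, Piece.bit, bitAt, hrb]

theorem renderPiece_neg (i : ℕ) (x : letters P) :
    E.renderPiece i (.neg x) = g i (flip (E.b x)) := by
  refine List.ext_getElem (by simp [g, flip, E.length_b x.2]) fun r hr hr' => ?_
  have hrb : r < (E.b x).length := by simpa [g, flip] using hr'
  simp [renderPiece, g, flip, Piece.bit, bitAt, hrb]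

theorem length_renderTile (i : ℕ) (T : Tile (letters P)) :
    (E.renderTile i T).length = 3 * E.len := by
  simp only [renderTile, List.length_append, length_renderPiece]
  ring

theorem fits_renderPiece (i : ℕ) (T : Tile (letters P)) (a : Fin 3) :
    Fits (E.renderPiece i (T.piece a)) (E.renderTile i T) (a * E.len) :=
  Fits.append_three (C := fun a => E.renderPiece i (T.piece a))
    (fun _ => length_renderPiece i _) a

/-- One of the strings `f_L(x)`, `f_M(x)`, `f_R(x)` with the character `i`: a string `S` of length
`3ℓ'` that reads `T` from column `o` on. -/
structure IsBlock (E : BitCode P) (i : ℕ) (S : WStr) (T : Tile (letters P)) (o : ℕ) : Prop where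
  length_eq : S.length = 3 * E.len
  fits : Fits (E.renderTile i T) S (o * E.len)

theorem isBlock_renderTile (i : ℕ) (T : Tile (letters P)) :
    IsBlock E i (E.renderTile i T) T 0 :=
  ⟨length_renderTile i T, fun d i h => by rwa [zero_mul, zero_add]⟩

theorem isBlock_replicate (i : ℕ) :
    IsBlock E i (List.replicate (3 * E.len) (some i)) .full 0 := by
  have hfull : List.replicate (3 * E.len) (some i) = E.renderTile i .full := by
    simp only [renderTile, Tile.piece, Matrix.cons_val, renderPiece_full,
      List.replicate_append_replicate]
    congr 1
    ring
  exact hfull ▸ isBlock_renderTile i _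

theorem isBlock_fL (i : ℕ) (x : letters P) : IsBlock E i (E.fL i x) (.forward x) 0 := by
  have hx : E.fL i x = E.renderTile i (.forward x) := by
    obtain ⟨-, ⟨u, rfl⟩ | ⟨u, hu, rfl⟩⟩ := x <;>
      simp [fL, renderTile, Tile.piece, renderPiece_pos, renderPiece_neg, renderPiece_blank]
  exact hx ▸ isBlock_renderTile i _

theorem isBlock_fM (i : ℕ) (x : letters P) : IsBlock E i (E.fM i x) (.middle x) 0 := by
  have hx : E.fM i x = E.renderTile i (.middle x) := by
    obtain ⟨-, ⟨u, rfl⟩ | ⟨u, hu, rfl⟩⟩ := x <;>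
      simp [fM, renderTile, Tile.piece, renderPiece_pos, renderPiece_neg, renderPiece_blank]
  exact hx ▸ isBlock_renderTile i _

theorem isBlock_fR (i : ℕ) (x : letters P) : IsBlock E i (E.fR i x) (.forward x) 1 := by
  have hx : E.fR i x = E.renderPiece i .blank ++ E.renderPiece i (.pos x) ++
      E.renderPiece i (.neg x) := by
    obtain ⟨-, ⟨u, rfl⟩ | ⟨u, hu, rfl⟩⟩ := x <;>
      simp [fR, renderPiece_pos, renderPiece_neg, renderPiece_blank]
  rw [hx]
  refine ⟨by simp only [List.length_append, length_renderPiece]; ring, ?_⟩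
  have htile : E.renderTile i (.forward x) = E.renderPiece i (.pos x) ++ E.renderPiece i (.neg x) ++
      List.replicate E.len none := by
    rw [← renderPiece_blank i]
    rfl
  rw [htile, List.append_assoc (E.renderPiece i .blank), one_mul,
    ← length_renderPiece (E := E) i .blank]
  exact (Fits.suffix_append _ _).append_replicate_none _

theorem fits_renderTile_blank (i : ℕ) (S : WStr) (p : ℕ) : Fits (E.renderTile i .blank) S p := by
  intro d c h
  have hmem := List.mem_of_getElem? h
  simp [renderTile, Tile.piece, renderPiece_blank] at hmem

/-- A string `S` that consists of at most three blocks, which read the tiles `T j`, the block `j`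
from its column `o j` on; missing blocks correspond to blank tiles. -/
structure IsRendering (E : BitCode P) (i : ℕ) (S : WStr) (T : Fin 3 → Tile (letters P))
    (o : Fin 3 → ℕ) : Prop where
  dvd_length : 3 * E.len ∣ S.length
  fits : ∀ j : Fin 3, Fits (E.renderTile i (T j)) S ((3 * j + o j) * E.len)

theorem IsBlock.isRendering {i : ℕ} {S : WStr} {T : Tile (letters P)} {o : ℕ}
    (hS : IsBlock E i S T o) : IsRendering E i S ![T, .blank, .blank] fun _ => o := by
  refine ⟨hS.length_eq ▸ dvd_rfl, fun j => ?_⟩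
  fin_cases j
  · simpa using hS.fits
  · exact fits_renderTile_blank i S _
  · exact fits_renderTile_blank i S _

theorem isRendering_append_three {i : ℕ} {S : Fin 3 → WStr} {T : Fin 3 → Tile (letters P)}
    {o : Fin 3 → ℕ} (hS : ∀ j, IsBlock E i (S j) (T j) (o j)) :
    IsRendering E i (S 0 ++ S 1 ++ S 2) T o where
  dvd_length := by
    simp only [List.length_append, (hS _).length_eq]
    exact ⟨3, by ring⟩
  fits j := by
    convert (hS j).fits.trans (Fits.append_three (fun j => (hS j).length_eq) j) using 1
    ring

theorem isRendering_f {i : ℕ} {x : Triple V} {T₀ T₁ T₂ : Tile (letters P)} {o₀ o₁ o₂ : ℕ}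
    (hL : IsBlock E i (E.fL i x.1) T₀ o₀) (hM : IsBlock E i (E.fM i x.2.1) T₁ o₁)
    (hR : IsBlock E i (E.fR i x.2.2) T₂ o₂) :
    IsRendering E i (E.f i x) ![T₀, T₁, T₂] ![o₀, o₁, o₂] :=
  isRendering_append_three (S := ![E.fL i x.1, E.fM i x.2.1, E.fR i x.2.2]) fun j => by
    fin_cases j
    exacts [hL, hM, hR]

end BitCode

/-- The node `u` as an element of `V ∪ W`. -/
def letterV (u : V) : letters P := ⟨.v u, .inl ⟨u, rfl⟩⟩

/-- The additional letter of the node `u` as an element of `V ∪ W`. -/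
def letterW (u : {u : V // u ≠ P.t}) : letters P := ⟨.w u, .inr ⟨u, u.2, rfl⟩⟩

theorem letterV_ne_letterW (u : V) (u' : {u : V // u ≠ P.t}) : letterV u ≠ letterW u' := fun h =>
  absurd (congrArg Subtype.val h) nofun

end Letters

section Index

variable {V : Type*} {P : RDHP V}

/-- Edges, encoded by a node and the number of one of its children. -/
abbrev Edge (O : ChildOrder P) := Σ u : V, Fin (O.deg u)

/-- The input strings without repetitions: the strings of `A_{u,j}` and `B_{u,j}` for every edge,
the string of `C_u` for every node, and the patch strings. -/
inductive Index (O : ChildOrder P) where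
  | edgeA (e : Edge O) : Index O
  | edgeB (e : Edge O) : Index O
  | node (u : V) : Index O
  | middleW (u : {u : V // u ≠ P.t}) : Index O
  | leftW (u : {u : V // u ≠ P.t}) : Index O
  | middleV (u : {u : V // u ≠ P.s}) : Index O
  | rightV (u : {u : V // u ≠ P.s}) : Index O

open Classical in
/-- The string `C_u`, covering the three cases `u = s`, `u = t` and `u ≠ s, t`. -/
noncomputable def strC (P : RDHP V) (u : V) : Triple V :=
  (if u = P.s then .ddagger else .v u, .hash, if u = P.t then .dollar else .w u)

variable {O : ChildOrder P}

theorem Edge.fst_ne_t (e : Edge O) : e.1 ≠ P.t := by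
  obtain ⟨u, j⟩ := e
  rintro rfl
  have hadj : P.graph.Adj P.t (O.children P.t)[(j : ℕ)] :=
    (O.mem_children _ _).1 (List.getElem_mem j.2)
  exact P.no_out _ hadj

/-- The node that an edge leaves. -/
def Edge.source (e : Edge O) : {u : V // u ≠ P.t} := ⟨e.1, Edge.fst_ne_t e⟩

theorem c_succ_inj {u : V} {j j' : ℕ} (hj : j < O.deg u) (hj' : j' < O.deg u)
    (h : O.c u (j + 1) = O.c u (j' + 1)) : j = j' := by
  have hlt (k : ℕ) : k % O.deg u < (O.children u).length := Nat.mod_lt k (Nat.zero_lt_of_lt hj)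
  rw [ChildOrder.c, ChildOrder.c, List.getD_eq_getElem _ _ (hlt _),
    List.getD_eq_getElem _ _ (hlt _)] at h
  have hmod : j + 1 ≡ j' + 1 [MOD O.deg u] := (O.nodup u).getElem_inj_iff.1 h
  exact (Nat.ModEq.add_right_cancel' 1 hmod).eq_of_lt_of_lt hj hj'

theorem strC_injective : Function.Injective (strC P) := by
  intro u u' h
  have hfst := congrArg Prod.fst h
  simp only [strC] at hfst
  split_ifs at hfst with hu hu'
  · exact hu.trans hu'.symm
  · exact Sym.v.inj hfst

theorem strC_mem_setC (u : V) : strC P u ∈ setC P := by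
  by_cases hs : u = P.s
  · exact .inl (.inl (by simp [strC, hs, P.s_ne_t]))
  by_cases ht : u = P.t
  · exact .inl (.inr (by simp [strC, ht, P.s_ne_t.symm]))
  · exact .inr ⟨u, hs, ht, by simp [strC, hs, ht]⟩

theorem exists_strC_eq {x : Triple V} (hx : x ∈ setC P) : ∃ u, strC P u = x := by
  obtain (rfl | rfl) | ⟨u, hs, ht, rfl⟩ := hx
  · exact ⟨P.s, by simp [strC, P.s_ne_t]⟩
  · exact ⟨P.t, by simp [strC, P.s_ne_t.symm]⟩
  · exact ⟨u, by simp [strC, hs, ht]⟩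

namespace Index

/-- The name of an input string. -/
noncomputable def name : Index O → Name V
  | edgeA e => .main (strA O e.1 (e.2 + 1))
  | edgeB e => .main (strB O e.1 (e.2 + 1))
  | node u => .main (strC P u)
  | middleW u => .patchM (.w u)
  | leftW u => .patchL (.w u)
  | middleV u => .patchM (.v u)
  | rightV u => .patchR (.v u)

theorem name_injective : Function.Injective (name : Index O → Name V) := by
  rintro (⟨i, j⟩ | ⟨i, j⟩ | u | u | u | u | u) (⟨i', j'⟩ | ⟨i', j'⟩ | u' | u' | u' | u' | u') h <;>
    simp only [name, strA, strB, Name.main.injEq, Prod.mk.injEq, Sym.w.injEq, Sym.v.injEq,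
      reduceCtorEq, and_false, Name.patchL.injEq, Name.patchM.injEq, Name.patchR.injEq] at h
  · obtain ⟨rfl, h, -⟩ := h
    rw [Fin.ext (c_succ_inj j.2 j'.2 h)]
  · simp [strC] at h
  · obtain ⟨h, rfl, -⟩ := h
    rw [Fin.ext (c_succ_inj j.2 j'.2 h)]
  · simp [strC] at h
  · simp [strC] at h
  · simp [strC] at h
  · rw [strC_injective h]
  all_goals rw [Subtype.ext h]

theorem name_mem (y : Index O) : y.name ∈ names O := by
  rcases y with e | e | u | u | u | u | u
  · exact .inl (.inl ⟨_, .inr ⟨e.1, Edge.fst_ne_t e, e.2 + 1,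
      Finset.mem_Icc.2 ⟨by omega, e.2.2⟩, .inl rfl⟩, rfl⟩)
  · exact .inl (.inl ⟨_, .inr ⟨e.1, Edge.fst_ne_t e, e.2 + 1,
      Finset.mem_Icc.2 ⟨by omega, e.2.2⟩, .inr rfl⟩, rfl⟩)
  · exact .inl (.inl ⟨_, .inl (strC_mem_setC u), rfl⟩)
  · exact .inl (.inr ⟨u, u.2, .inl rfl⟩)
  · exact .inl (.inr ⟨u, u.2, .inr rfl⟩)
  · exact .inr ⟨u, u.2, .inl rfl⟩
  · exact .inr ⟨u, u.2, .inr rfl⟩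

theorem exists_name_eq {x : Name V} (hx : x ∈ names O) : ∃ y : Index O, y.name = x := by
  obtain (⟨x, hx | ⟨u, -, j, hj, hx⟩, rfl⟩ | ⟨u, hu, rfl | rfl⟩) | ⟨u, hu, rfl | rfl⟩ := hx
  · obtain ⟨u, rfl⟩ := exists_strC_eq hx
    exact ⟨.node u, rfl⟩
  · rw [Finset.mem_Icc] at hj
    obtain ⟨k, rfl⟩ := Nat.exists_eq_add_of_le' hj.1
    obtain rfl | rfl := hx
    · exact ⟨.edgeA ⟨u, k, hj.2⟩, rfl⟩
    · exact ⟨.edgeB ⟨u, k, hj.2⟩, rfl⟩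
  · exact ⟨.middleW ⟨u, hu⟩, rfl⟩
  · exact ⟨.leftW ⟨u, hu⟩, rfl⟩
  · exact ⟨.middleV ⟨u, hu⟩, rfl⟩
  · exact ⟨.rightV ⟨u, hu⟩, rfl⟩

open Classical in
/-- The tiles of an input string: three for the string of an element of `𝒯`, one for a patch
string. -/
noncomputable def tile : Index O → Fin 3 → Tile (letters P)
  | edgeA e => ![.forward (letterW e.source), .middle (letterV (O.c e.1 (e.2 + 1))),
      .forward (letterW e.source)]
  | edgeB e => ![.forward (letterV (O.c e.1 (e.2 + 1))), .middle (letterW e.source),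
      .forward (letterV (O.c e.1 (e.2 + 1 + 1)))]
  | node u => ![if u = P.s then .full else .forward (letterV u), .full,
      if h : u = P.t then .full else .forward (letterW ⟨u, h⟩)]
  | middleW u => ![.middle (letterW u), .blank, .blank]
  | leftW u => ![.forward (letterW u), .blank, .blank]
  | middleV u => ![.middle (letterV u), .blank, .blank]
  | rightV u => ![.forward (letterV u), .blank, .blank]

open Classical in
/-- The column of a block from which on it reads its tile: `f_R(x)` starts with a wildcard piece,
which is not part of the tile. -/
noncomputable def shift : Index O → Fin 3 → ℕ
  | edgeA _ => ![0, 0, 1]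
  | edgeB _ => ![0, 0, 1]
  | node u => ![0, 0, if u = P.t then 0 else 1]
  | middleW _ => fun _ => 0
  | leftW _ => fun _ => 0
  | middleV _ => fun _ => 0
  | rightV _ => fun _ => 1

theorem shift_monotone (y : Index O) : Monotone y.shift := by
  rw [Fin.monotone_iff_le_succ]
  intro j
  cases y <;> fin_cases j <;> simp [shift]

theorem tile_zero_ne_blank (y : Index O) : y.tile 0 ≠ .blank := by
  cases y with
  | node u =>
    simp only [tile, Matrix.cons_val_zero]
    split_ifs <;> exact nofun
  | _ => exact nofun

theorem isRendering (E : BitCode P) (i : ℕ) (y : Index O) :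
    BitCode.IsRendering E i (E.str i y.name) y.tile y.shift := by
  cases y with
  | edgeA e =>
    exact BitCode.isRendering_f (x := strA O e.1 (e.2 + 1))
      (BitCode.isBlock_fL i (letterW e.source)) (BitCode.isBlock_fM i (letterV _))
      (BitCode.isBlock_fR i (letterW e.source))
  | edgeB e =>
    exact BitCode.isRendering_f (x := strB O e.1 (e.2 + 1)) (BitCode.isBlock_fL i (letterV _))
      (BitCode.isBlock_fM i (letterW e.source)) (BitCode.isBlock_fR i (letterV _))
  | node u =>
    refine BitCode.isRendering_f ?_ (BitCode.isBlock_replicate i) ?_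
    · simp only [strC]
      split_ifs
      · exact BitCode.isBlock_replicate i
      · exact BitCode.isBlock_fL i (letterV u)
    · simp only [strC]
      split_ifs with h
      · exact BitCode.isBlock_replicate i
      · exact BitCode.isBlock_fR i (letterW ⟨u, h⟩)
  | middleW u => exact (BitCode.isBlock_fM i (letterW u)).isRendering
  | leftW u => exact (BitCode.isBlock_fL i (letterW u)).isRendering
  | middleV u => exact (BitCode.isBlock_fM i (letterV u.1)).isRendering
  | rightV u => exact (BitCode.isBlock_fR i (letterV u.1)).isRendering

/-- The input strings, sorted by their kinds. -/
def equivSum (O : ChildOrder P) : Index O ≃ (Edge O ⊕ Edge O) ⊕ V ⊕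
    ({u : V // u ≠ P.t} ⊕ {u : V // u ≠ P.t}) ⊕ ({u : V // u ≠ P.s} ⊕ {u : V // u ≠ P.s}) where
  toFun
    | edgeA e => .inl (.inl e)
    | edgeB e => .inl (.inr e)
    | node u => .inr (.inl u)
    | middleW u => .inr (.inr (.inl (.inl u)))
    | leftW u => .inr (.inr (.inl (.inr u)))
    | middleV u => .inr (.inr (.inr (.inl u)))
    | rightV u => .inr (.inr (.inr (.inr u)))
  invFun
    | .inl (.inl e) => edgeA e
    | .inl (.inr e) => edgeB e
    | .inr (.inl u) => node u
    | .inr (.inr (.inl (.inl u))) => middleW u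
    | .inr (.inr (.inl (.inr u))) => leftW u
    | .inr (.inr (.inr (.inl u))) => middleV u
    | .inr (.inr (.inr (.inr u))) => rightV u
  left_inv y := by cases y <;> rfl
  right_inv y := by rcases y with (_ | _) | _ | (_ | _) | (_ | _) <;> rfl

instance [Finite V] : Finite (Index O) := Finite.of_equiv _ (equivSum O).symm

theorem sum_eq [Fintype V] [Fintype {u : V // u ≠ P.t}] [Fintype {u : V // u ≠ P.s}]
    [Fintype (Index O)] (F : Index O → ℕ) :
    ∑ y, F y = (∑ e, F (edgeA e) + ∑ e, F (edgeB e)) + (∑ u, F (node u) +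
      ((∑ u, F (middleW u) + ∑ u, F (leftW u)) + (∑ u, F (middleV u) + ∑ u, F (rightV u)))) := by
  rw [← (equivSum O).symm.sum_comp]
  simp only [Fintype.sum_sum_type]
  rfl

theorem card_edge (O : ChildOrder P) : Nat.card (Edge O) = P.m := by
  classical
  have e (u : V) : Fin (O.deg u) ≃ {x : V // P.graph.Adj u x} :=
    ((O.nodup u).getEquiv _).trans (Equiv.subtypeEquivRight (O.mem_children u))
  rw [RDHP.m, ← Nat.card_coe_set_eq]
  exact Nat.card_congr ((Equiv.sigmaCongrRight e).trans (Equiv.subtypeProdEquivSigmaSubtype _).symm)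

open Classical in
theorem sum_area_node (u : V) : ∑ j, ((node u : Index O).tile j).area =
    5 + ((if u = P.s then 2 else 0) + if u = P.t then 2 else 0) := by
  rw [Fin.sum_univ_three]
  simp only [tile, Matrix.cons_val]
  split_ifs <;> rfl

theorem sum_area [Finite V] [Fintype (Index O)] :
    ∑ y : Index O, ∑ j, (y.tile j).area = 3 * (2 * P.m + 3 * P.n) := by
  classical
  have := Fintype.ofFinite V
  have hm : Fintype.card (Edge O) = P.m := Nat.card_eq_fintype_card.symm.trans (card_edge O)
  have hn : Fintype.card V = P.n := Nat.card_eq_fintype_card.symm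
  have hpos : 0 < P.n := hn ▸ Fintype.card_pos_iff.2 ⟨P.s⟩
  have hcard (u₀ : V) : Fintype.card {u : V // u ≠ u₀} = P.n - 1 := by
    rw [Fintype.card_subtype_compl, Fintype.card_subtype_eq, hn]
  have hA (e : Edge O) : ∑ j, ((edgeA e).tile j).area = 3 := rfl
  have hB (e : Edge O) : ∑ j, ((edgeB e).tile j).area = 3 := rfl
  have hmW (u : {u : V // u ≠ P.t}) : ∑ j, ((middleW u : Index O).tile j).area = 1 := rfl
  have hlW (u : {u : V // u ≠ P.t}) : ∑ j, ((leftW u : Index O).tile j).area = 1 := rfl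
  have hmV (u : {u : V // u ≠ P.s}) : ∑ j, ((middleV u : Index O).tile j).area = 1 := rfl
  have hrV (u : {u : V // u ≠ P.s}) : ∑ j, ((rightV u : Index O).tile j).area = 1 := rfl
  rw [sum_eq]
  simp only [sum_area_node, hA, hB, hmW, hlW, hmV, hrV, Finset.sum_add_distrib, Finset.sum_const,
    Finset.card_univ, Finset.sum_ite_eq', Finset.mem_univ, if_true, smul_eq_mul, hm, hn, hcard]
  omega

/-- The column in which the tile of the block `p` starts if the input strings start in the columns
given by `τ`. -/
noncomputable def column (τ : Index O → ℕ) (p : Index O × Fin 3) : ℕ :=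
  τ p.1 + (3 * p.2 + p.1.shift p.2)

/-- Placed in the columns given by `τ`, the tiles of all input strings fill `3K` columns. -/
abbrev TilesColumns (K : ℕ) (τ : Index O → ℕ) : Prop :=
  IsColumnTiling (3 * K) (fun p : Index O × Fin 3 => p.1.tile p.2) (column τ)

theorem shift_add_inj {y : Index O} {j j' a a' : Fin 3}
    (h : 3 * j + y.shift j + a = 3 * j' + y.shift j' + (a' : ℕ)) : j = j' ∧ a = a' := by
  obtain hj | rfl | hj := lt_trichotomy j j'
  · have := y.shift_monotone hj.le
    omega
  · exact ⟨rfl, by omega⟩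
  · have := y.shift_monotone hj.le
    omega

section Columns

variable {τ : Index O → ℕ} {K : ℕ}

theorem three_dvd_of_middle (hT : TilesColumns K τ) {y : Index O} {j : Fin 3} {x : letters P}
    (hj : y.tile j = .middle x) (hs : y.shift j = 0) : 3 ∣ τ y := by
  have h := hT.mod_three_add_width_le (i := (y, j)) (hj.trans_ne nofun)
  simp only [hj, column, hs, Tile.width] at h
  omega

theorem three_dvd_node (hT : TilesColumns K τ) (u : V) : 3 ∣ τ (node u) := by
  have h : (τ (node u) + 3) % 3 + 3 ≤ 3 := hT.mod_three_add_width_le (i := (node u, 1)) nofun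
  omega

theorem column_mod_three {p : Index O × Fin 3} (h : 3 ∣ τ p.1) :
    column τ p % 3 = p.1.shift p.2 % 3 := by
  rw [column]
  omega

theorem middle_cases {y : Index O} {j : Fin 3} {x : letters P} (h : y.tile j = .middle x) :
    (∃ e, (y, j) = (edgeA e, 1) ∧ letterV (O.c e.1 (e.2 + 1)) = x) ∨
      (∃ e, (y, j) = (edgeB e, 1) ∧ letterW e.source = x) ∨
      (∃ u, (y, j) = (middleW u, 0) ∧ letterW u = x) ∨
      ∃ u, (y, j) = (middleV u, 0) ∧ letterV u.1 = x := by
  cases y with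
  | node u =>
    exfalso
    revert h
    fin_cases j <;> simp only [tile, Matrix.cons_val, Fin.reduceFinMk, Fin.zero_eta] <;>
      (try split_ifs) <;> exact nofun
  | _ => fin_cases j <;> simp_all [tile]

theorem three_dvd_leftW [Finite V] (hT : TilesColumns K τ) (u : {u : V // u ≠ P.t}) :
    3 ∣ τ (leftW u) := by
  by_contra hu
  have hphase : τ (leftW u) % 3 + 2 ≤ 3 := hT.mod_three_add_width_le (i := (leftW u, 0)) nofun
  let fwd : Edge O ⊕ {u : V // u ≠ P.t} → Index O × Fin 3 :=
    Sum.elim (fun e => (edgeA e, 2)) fun u => (node u, 2)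
  let mid : Edge O ⊕ {u : V // u ≠ P.t} → Index O × Fin 3 :=
    Sum.elim (fun e => (edgeB e, 1)) fun u => (middleW u, 0)
  have hinj : Function.Injective fwd := by
    rintro (e | v) (e' | v') h <;> simp_all [fwd, Subtype.ext_iff]
  have hfwd (m) : ∃ x ∈ Set.range letterW, (fwd m).1.tile (fwd m).2 = .forward x ∧
      column τ (fwd m) % 3 = 1 := by
    obtain e | v := m
    · have hcol := column_mod_three (p := (edgeA e, 2)) (three_dvd_of_middle hT (j := 1) rfl rfl)
      exact ⟨_, ⟨e.source, rfl⟩, rfl, hcol⟩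
    · have hcol := column_mod_three (p := (node v.1, 2)) (three_dvd_node hT v)
      exact ⟨_, ⟨v, rfl⟩, by simp [fwd, tile, v.2], hcol.trans (by simp [shift, v.2])⟩
  have hmid (i : Index O × Fin 3) (x) (hx : x ∈ Set.range letterW)
      (hi : i.1.tile i.2 = .middle x) : i ∈ Set.range mid := by
    obtain ⟨v, rfl⟩ := hx
    obtain ⟨e, -, he⟩ | ⟨e, hi, -⟩ | ⟨v', hi, -⟩ | ⟨v', -, hv⟩ := middle_cases hi
    · exact absurd he (letterV_ne_letterW _ _)
    · exact ⟨.inl e, hi.symm⟩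
    · exact ⟨.inr v', hi.symm⟩
    · exact absurd hv (letterV_ne_letterW _ _)
  have hcol : column τ (leftW u, 0) % 3 = 1 := (by omega : τ (leftW u) % 3 = 1)
  obtain ⟨e | v, h⟩ := hT.mem_range_forward hinj hfwd hmid ⟨u, rfl⟩ (i := (leftW u, 0)) rfl hcol
  all_goals simp [fwd] at h

theorem three_dvd_rightV [Finite V] (hT : TilesColumns K τ) (u : {u : V // u ≠ P.s}) :
    3 ∣ τ (rightV u) := by
  by_contra hu
  have hphase : (τ (rightV u) + 1) % 3 + 2 ≤ 3 :=
    hT.mod_three_add_width_le (i := (rightV u, 0)) nofun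
  let fwd : Edge O ⊕ {u : V // u ≠ P.s} → Index O × Fin 3 :=
    Sum.elim (fun e => (edgeB e, 0)) fun u => (node u, 0)
  let mid : Edge O ⊕ {u : V // u ≠ P.s} → Index O × Fin 3 :=
    Sum.elim (fun e => (edgeA e, 1)) fun u => (middleV u, 0)
  have hinj : Function.Injective fwd := by
    rintro (e | v) (e' | v') h <;> simp_all [fwd, Subtype.ext_iff]
  have hfwd (m) : ∃ x ∈ Set.range letterV, (fwd m).1.tile (fwd m).2 = .forward x ∧
      column τ (fwd m) % 3 = 0 := by
    obtain e | v := m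
    · have hcol := column_mod_three (p := (edgeB e, 0)) (three_dvd_of_middle hT (j := 1) rfl rfl)
      exact ⟨_, ⟨O.c e.1 (e.2 + 1), rfl⟩, rfl, hcol⟩
    · have hcol := column_mod_three (p := (node v.1, 0)) (three_dvd_node hT v)
      exact ⟨_, ⟨v, rfl⟩, by simp [fwd, tile, v.2], hcol⟩
  have hmid (i : Index O × Fin 3) (x) (hx : x ∈ Set.range letterV)
      (hi : i.1.tile i.2 = .middle x) : i ∈ Set.range mid := by
    obtain ⟨v, rfl⟩ := hx
    obtain ⟨e, hi, -⟩ | ⟨e, -, he⟩ | ⟨v', -, hv⟩ | ⟨v', hi, -⟩ := middle_cases hi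
    · exact ⟨.inl e, hi.symm⟩
    · exact absurd he.symm (letterV_ne_letterW _ _)
    · exact absurd hv.symm (letterV_ne_letterW _ _)
    · exact ⟨.inr v', hi.symm⟩
  have hcol : column τ (rightV u, 0) % 3 = 0 := (by omega : (τ (rightV u) + 1) % 3 = 0)
  obtain ⟨e | v, h⟩ := hT.mem_range_forward hinj hfwd hmid ⟨u.1, rfl⟩ (i := (rightV u, 0)) rfl hcol
  all_goals simp [fwd] at h

theorem three_dvd [Finite V] (hT : TilesColumns K τ) (y : Index O) : 3 ∣ τ y := by
  cases y with
  | edgeA e => exact three_dvd_of_middle hT (j := 1) rfl rfl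
  | edgeB e => exact three_dvd_of_middle hT (j := 1) rfl rfl
  | node u => exact three_dvd_node hT u
  | middleW u => exact three_dvd_of_middle hT (j := 0) rfl rfl
  | leftW u => exact three_dvd_leftW hT u
  | middleV u => exact three_dvd_of_middle hT (j := 0) rfl rfl
  | rightV u => exact three_dvd_rightV hT u

end Columns

section Placement

variable {E : BitCode P} {ι : Name V → ℕ} {Q : WStr} {s : Index O → ℕ}

/-- The position of the piece `a` of the tile of the block `j` in the string `y`. -/
noncomputable def offset (E : BitCode P) (y : Index O) (j a : Fin 3) : ℕ :=
  (3 * j + y.shift j + a) * E.len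

theorem str_getElem? (i : ℕ) (y : Index O) (j a : Fin 3) {r : ℕ} (hr : r < E.len)
    (hbit : ((y.tile j).piece a).bit E.bitAt r = true) :
    (E.str i y.name)[y.offset E j a + r]? = some (some i) := by
  rw [offset, add_mul]
  exact (BitCode.fits_renderPiece i (y.tile j) a).trans ((y.isRendering E i).fits j) r i
    (BitCode.renderPiece_getElem? i hr hbit)

/-- Every input string `y`, written with the character `ι y`, stands in `Q` at position `s y`
(counted from `0`). -/
def IsPlacement (E : BitCode P) (ι : Name V → ℕ) (Q : WStr) (s : Index O → ℕ) : Prop :=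
  ∀ y, Fits (E.str (ι y.name) y.name) Q (s y)

namespace IsPlacement

theorem getElem?_of_mem_occupied (hs : IsPlacement E ι Q s) {y : Index O} {j a : Fin 3} {p : ℕ}
    (hp : p ∈ ((y.tile j).piece a).occupied E.bitAt E.len (s y + y.offset E j a)) :
    Q[p]? = some (some (ι y.name)) := by
  obtain ⟨r, hr, hbit, rfl⟩ := Piece.mem_occupied.1 hp
  rw [add_assoc]
  exact hs y _ _ (str_getElem? _ y j a hr hbit)

theorem eq_of_getElem? (hι : Set.InjOn ι (names O)) {y y' : Index O} {p : ℕ}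
    (hy : Q[p]? = some (some (ι y.name))) (hy' : Q[p]? = some (some (ι y'.name))) : y = y' :=
  name_injective <| hι y.name_mem y'.name_mem <|
    Option.some.inj (Option.some.inj (hy.symm.trans hy'))

theorem isTiling [Finite V] (hs : IsPlacement E ι Q s) (hι : Set.InjOn ι (names O))
    (hQ : Q.length = 3 * (2 * P.m + 3 * P.n) * E.len) :
    IsTiling E.bitAt E.len (3 * (2 * P.m + 3 * P.n) * E.len)
      (fun q : (Index O × Fin 3) × Fin 3 => (q.1.1.tile q.1.2).piece q.2)
      fun q => s q.1.1 + q.1.1.offset E q.1.2 q.2 := by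
  have := Fintype.ofFinite (Index O)
  refine .of_le_sum_card ?_ ?_ ?_
  · rintro ⟨⟨y, j⟩, a⟩ ⟨⟨y', j'⟩, a'⟩ p hp hp'
    obtain rfl := eq_of_getElem? hι (hs.getElem?_of_mem_occupied hp)
      (hs.getElem?_of_mem_occupied hp')
    obtain ⟨r, hr, -, rfl⟩ := Piece.mem_occupied.1 hp
    obtain ⟨r', hr', -, (heq : s y + y.offset E j' a' + r' = s y + y.offset E j a + r)⟩ :=
      Piece.mem_occupied.1 hp'
    have hcol : y.offset E j a + r = y.offset E j' a' + r' := by omega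
    have hpos : 0 < E.len := (Nat.zero_le r).trans_lt hr
    have hdiv := congrArg (· / E.len) hcol
    simp only [offset, add_comm _ r, add_comm _ r', Nat.add_mul_div_right _ _ hpos,
      Nat.div_eq_of_lt hr, Nat.div_eq_of_lt hr', zero_add] at hdiv
    obtain ⟨rfl, rfl⟩ := shift_add_inj hdiv
    rfl
  · rintro ⟨⟨y, j⟩, a⟩ p hp
    exact hQ ▸ (List.getElem?_eq_some_iff.1 (hs.getElem?_of_mem_occupied hp)).1
  · rw [Fintype.sum_prod_type, Fintype.sum_prod_type]
    simp only [Tile.sum_card_occupied, ← Finset.sum_mul, sum_area, le_refl]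

theorem exists_tilesColumns [Finite V] (hs : IsPlacement E ι Q s) (hι : Set.InjOn ι (names O))
    (hQ : Q.length = 3 * (2 * P.m + 3 * P.n) * E.len) :
    ∃ τ, (∀ y, s y = E.len * τ y) ∧ TilesColumns (2 * P.m + 3 * P.n) τ := by
  have hT := hs.isTiling hι hQ
  have hdvd (y : Index O) : E.len ∣ s y := by
    have hy := hT.dvd E.isCode (j := ((y, 0), 0))
      (Tile.piece_zero_ne_blank y.tile_zero_ne_blank)
    exact (Nat.dvd_add_left (Dvd.intro_left _ rfl)).1 hy
  choose τ hτ using hdvd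
  refine ⟨τ, hτ, IsTiling.isColumnTiling E.isCode ?_⟩
  convert hT using 2 with q
  rw [hτ, offset, column]
  ring

theorem three_len_dvd [Finite V] (hs : IsPlacement E ι Q s) (hι : Set.InjOn ι (names O))
    (hQ : Q.length = 3 * (2 * P.m + 3 * P.n) * E.len) (y : Index O) : 3 * E.len ∣ s y := by
  obtain ⟨τ, hτ, hT⟩ := hs.exists_tilesColumns hι hQ
  rw [hτ, mul_comm]
  exact Nat.mul_dvd_mul_left _ (three_dvd hT y)

theorem eq_of_fits [Finite V] (hs : IsPlacement E ι Q s) (hι : Set.InjOn ι (names O))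
    (hQ : Q.length = 3 * (2 * P.m + 3 * P.n) * E.len) {y : Index O} {p : ℕ}
    (hp : Fits (E.str (ι y.name) y.name) Q p) : p = s y := by
  have hT := hs.isTiling hι hQ
  let D : Set ℕ := {d | (E.str (ι y.name) y.name)[d]? = some (some (ι y.name))}
  have hfin : D.Finite := (Set.finite_lt_nat (E.str (ι y.name) y.name).length).subset
    fun d hd => (List.getElem?_eq_some_iff.1 hd).1
  have hne : D.Nonempty := by
    obtain ⟨r, hr, hbit, -⟩ := Piece.mem_occupied.1 (E.isCode.add_lead_mem_occupied
      (Tile.piece_zero_ne_blank y.tile_zero_ne_blank) 0)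
    exact ⟨_, str_getElem? _ y 0 0 hr hbit⟩
  refine eq_of_forall_add_eq hfin hne fun d hd => ?_
  have hQd := hp d _ hd
  obtain ⟨⟨⟨y', j⟩, a⟩, hcell⟩ := hT.exists_mem (p + d) (hQ ▸ (List.getElem?_eq_some_iff.1 hQd).1)
  obtain rfl := eq_of_getElem? hι hQd (hs.getElem?_of_mem_occupied hcell)
  obtain ⟨r, hr, hbit, heq⟩ := Piece.mem_occupied.1 hcell
  exact ⟨_, str_getElem? _ y j a hr hbit, by rw [← heq, add_assoc]⟩

end IsPlacement

end Placement

end Index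

end Index

end Soda

theorem mainTheorem4 {V : Type*} [Finite V] (P : Soda.RDHP V) (O : Soda.ChildOrder P)
    (E : Soda.BitCode P) (ι : Soda.Name V → ℕ) (hι : Set.InjOn ι (Soda.names O))
    (Q : Soda.WStr) (hQ : Q.length = (2 * P.m + 3 * P.n) * (3 * E.len))
    (hmatch : ∀ S ∈ Soda.setT' O E ι, Soda.HasMatch S Q) :
    ∀ S ∈ Soda.setT' O E ι,
      ∃ e, Soda.OccursEndingAt S Q e ∧ 3 * E.len ∣ e ∧
        ∀ e', Soda.OccursEndingAt S Q e' → e' = e := by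
  rintro S ⟨x, hx, rfl⟩
  obtain ⟨y, rfl⟩ := Soda.Index.exists_name_eq hx
  choose e he using fun y : Soda.Index O => hmatch _ ⟨y.name, y.name_mem, rfl⟩
  have hs : Soda.Index.IsPlacement E ι Q fun y => e y - (E.str (ι y.name) y.name).length :=
    fun y => (he y).fits
  have hQ' : Q.length = 3 * (2 * P.m + 3 * P.n) * E.len := hQ.trans (by ring)
  refine ⟨e y, he y, ?_, fun e' he' => ?_⟩
  · exact (Nat.dvd_sub_iff_left (he y).1 (y.isRendering E (ι y.name)).dvd_length).1
      (hs.three_len_dvd hι hQ' y)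
  · have hpos := hs.eq_of_fits hι hQ' he'.fits
    have hle := he'.1
    have hle' := (he y).1
    omega
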